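/- Let $r\ge 1$ and let $n_1,\dots,n_r\ge 0$ be integers, $\tilde n=\sum_{i=1}^r n_i$. Let $B_m$ be the Bernoulli numbers, $\sum_{m\ge0} B_m z^m/m! = z/(e^z-1)$. For a tuple $k=(k_1,\dots,k_r)$ of non-negative integers put $$M_j(k)=\sum_{i=j}^r n_i+(r-j+1)-\sum_{i=j+1}^r k_i\quad(1\le j\le r),\qquad c(k)=\prod_{j=1}^r\binom{M_j(k)}{k_j}\frac{B_{k_j}}{M_j(k)} .$$ The multiple power sum $H_{-n_1,\dots,-n_r}(N)=\sum_{N>i_1>\cdots>i_r>0} i_1^{n_1}\cdots i_r^{n_r}$ has the expansion $\sum_k c(k)\,N^{\tilde n+r-\sum_i k_i}$, where $k$ runs over the tuples with $0\le k_j\le M_j(k)-1$ for all $j$; it has no constant term. Define its formal constant term by restoring the tuples for which the exponent of $N$ is $0$: $$C(n_1,\dots,n_r)=\sum_{\substack{k_1+\cdots+k_r=\tilde n+r\\ 0\le k_j\le M_j(k)\ (1\le j\le r)}} c(k).$$ Consider the multiple zeta function $$\zeta(s_1,\dots,s_r)=\sum_{0<p_1<\cdots<p_r}\frac1{p_1^{s_1}\cdots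 p_r^{s_r}}=\sum_{m_1,\dots,m_r\ge1}\ \prod_{j=1}^r (m_1+\cdots+m_j)^{-s_j}$$ and, for $a\in[0,\infty)^r$, the integral $$Y(s;a)=\int_{[1,\infty)^r}\prod_{j=1}^r (x_1+a_1+\cdots+x_j+a_j)^{-s_j}\,dx .$$ Since a function of several variables can have points of indeterminacy at $(-n_1,\dots,-n_r)$, its analytic continuation to this point is understood one variable at a time, the last variable first: for $s_1,\dots,s_{r-1}$ of large real part continue meromorphically in $s_r$ from a right half-plane to a half-plane containing $-n_r$, the continuation being holomorphic at $-n_r$, and put $s_r=-n_r$; then continue the resulting function in $s_{r-1}$ to $-n_{r-1}$, and so on down to $s_1=-n_1$. Raabe's (Sadaoui's) value $\zeta(-n_1,\dots,-n_r)$ is the number $P(0)$, where $P$ is a polynomial in $r$ variables such that for all $a\in[0,\infty)^r$ the function $Y(\,\cdot\,;a)$ has a continuation to $(-n_1,\dots,-n_r)$ with value $$Y(-n_1,\dots,-n_r;a)=\int_{[0,1]^r}P(a+t)\,dt$$ (Raabe's identity). Then Raabe's value exists, is unique, and satisfies $$C(n_1,\dots,n_r)=(-1)^{\tilde n}\,\zeta(-n_1,\dots,-n_r).$$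 Moreover the series $\zeta(s_1,\dots,s_r)$ itself has a continuation to $(-n_1,\dots,-n_r)$ in the above sense, and its value there is the same number. -/

import Mathlib

/-- The integer `∑_{i ≥ j} n_i + (r - j + 1) - ∑_{i > j} k_i` (with `j` counted from `1`; as an
element of `Fin r` the index `j` is counted from `0`, so that `r - j + 1` becomes `r - j`). -/
def faulhaberUpper {r : ℕ} (n k : Fin r → ℕ) (j : Fin r) : ℤ :=
  ∑ i ∈ Finset.Ici j, (n i : ℤ) + ((r : ℤ) - ((j : ℕ) : ℤ)) - ∑ i ∈ Finset.Ioi j, (k i : ℤ)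

/-- The coefficient attached to the tuple `k` in the expansion of
`∑_{N > i_1 > ⋯ > i_r > 0} i_1 ^ n_1 ⋯ i_r ^ n_r` in powers of `N`.
Here `bernoulli 1 = -1/2`. -/
noncomputable def faulhaberCoeff {r : ℕ} (n k : Fin r → ℕ) : ℚ :=
  ∏ j, ((Ring.choose (faulhaberUpper n k j) (k j) : ℤ) : ℚ) *
    (bernoulli (k j) / (faulhaberUpper n k j : ℚ))

/-- The tuples `k` for which the power of `N` attached to `k`, namely `∑ n_i + r - ∑ k_i`,
is zero. The binomial coefficients are required to be in range, `k_j ≤ faulhaberUpper n k j`;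
this makes every `faulhaberUpper n k j` positive. For any other tuple, if `j` is the last
index that violates the bound, the `j`-th binomial coefficient is zero. -/
def constantTuples {r : ℕ} (n : Fin r → ℕ) : Finset (Fin r → ℕ) :=
  {k ∈ Finset.piAntidiag Finset.univ (∑ i, n i + r) | ∀ j, (k j : ℤ) ≤ faulhaberUpper n k j}

/-- The formal constant term of the expansion. -/
noncomputable def formalConstantTerm {r : ℕ} (n : Fin r → ℕ) : ℚ :=
  ∑ k ∈ constantTuples n, faulhaberCoeff n k

/-- The multiple zeta function
`∑_{0 < p_1 < ⋯ < p_r} p_1 ^ (-s_1) ⋯ p_r ^ (-s_r)`, written with `p_j = m_1 + ⋯ + m_j`. -/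
noncomputable def multipleZeta {r : ℕ} (s : Fin r → ℂ) : ℂ :=
  ∑' m : Fin r → ℕ+, ∏ j, ((∑ i ∈ Finset.Iic j, (m i : ℕ) : ℕ) : ℂ) ^ (-s j)

/-- The integral
`∫_{[1, ∞)^r} ∏_j (x_1 + a_1 + ⋯ + x_j + a_j) ^ (-s_j) dx_1 ⋯ dx_r`. -/
noncomputable def multipleZetaIntegral {r : ℕ} (a : Fin r → ℝ) (s : Fin r → ℂ) : ℂ :=
  ∫ x in Set.Ici (1 : Fin r → ℝ),
    ∏ j, ((∑ i ∈ Finset.Iic j, (x i + a i) : ℝ) : ℂ) ^ (-s j)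

/-- `f`, given on some right half-plane, extends to a function that is meromorphic on an open
half-plane containing `p`, holomorphic at `p`, and that takes the value `v` at `p`. -/
def HasContinuation (f : ℂ → ℂ) (p v : ℂ) : Prop :=
  ∃ (g : ℂ → ℂ) (σ τ : ℝ), (∀ w : ℂ, σ < w.re → g w = f w) ∧
    MeromorphicOn g {w : ℂ | τ < w.re} ∧ τ < p.re ∧ AnalyticAt ℂ g p ∧ g p = v

/-- `v` is the value at `p` of the analytic continuation of `F`, carried out one variable at a
time, the last variable first: `v = F(p_1, …, p_r)`, where `F(s_1, …, s_{r-1}, p_r)` is obtained by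
continuation in the last variable for `s_1, …, s_{r-1}` of large real part, then
`F(s_1, …, s_{r-2}, p_{r-1}, p_r)` by continuation in `s_{r-1}`, and so on. -/
def HasIteratedContinuation : (r : ℕ) → ((Fin r → ℂ) → ℂ) → (Fin r → ℂ) → ℂ → Prop
  | 0, F, p, v => F p = v
  | r + 1, F, p, v => ∃ G : (Fin r → ℂ) → ℂ,
      (∃ A : ℝ, ∀ s : Fin r → ℂ, (∀ i, A < (s i).re) →
        HasContinuation (fun w => F (Fin.snoc s w)) (p (Fin.last r)) (G s)) ∧
      HasIteratedContinuation r G (Fin.init p) v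

/-- `z` is the value of the multiple zeta function at `(-n_1, …, -n_r)` obtained from Raabe's
identity `∫_{[0,1]^r} Z(s; a + t) dt = Y(s; a)`, where
`Z(s; a) = ∑_{m_1, …, m_r ≥ 1} ∏_j (m_1 + a_1 + ⋯ + m_j + a_j) ^ (-s_j)` and
`Y(s; a) = multipleZetaIntegral a s`: continue the integral `Y(s; a)` to `s = -n`, invert the
identity there by a polynomial `P` in the shift `a`, and put `a = 0`. -/
def IsRaabeValue {r : ℕ} (n : Fin r → ℕ) (z : ℂ) : Prop :=
  ∃ P : MvPolynomial (Fin r) ℂ,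
    (∀ a : Fin r → ℝ, (∀ i, 0 ≤ a i) →
      HasIteratedContinuation r (multipleZetaIntegral a) (fun i => -(n i : ℂ))
        (∫ t in Set.Icc (0 : Fin r → ℝ) 1,
          MvPolynomial.eval (fun i => ((a i + t i : ℝ) : ℂ)) P)) ∧
    z = MvPolynomial.eval 0 P

open MeasureTheory Filter Topology Set
open scoped Polynomial

/-! The series and the integral are the same kind of object: an iterated integral of `∏ y_j ^
(-s_j)` over partial sums `y_j`, against counting measure for the series and Lebesgue measure for
`Y`. The innermost integral `∫ (y + X) ^ (-w) dμ` continues to `w = -n`, and its value there is a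
polynomial in `y`: `-1/(n+1)` times `∑ (n+1 choose k) β_k y ^ (n+1-k)`. Here `β_k = bernoulli' k`
for the series (`hasRegularizedTail_nat`) and `β_k = (1 + a) ^ k` for the integral
(`hasRegularizedTail_Ici`). Setting the last variable to `-n_r` therefore leaves an integral of the
same shape in one variable fewer, with a polynomial in `y_{r-1}` inserted, and the process repeats
(`hasIteratedContinuation_nestedIntegral`).

Unwinding the recursion writes the final value as a sum over `constantTuples n` of a rational
coefficient times `∏ β_j (k_j)` (`nestedValue_one`): after the last step the polynomial is evaluated
at `0`, so only tuples of total exponent zero survive. For `β = bernoulli'` this is the formal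
constant term up to the sign `(-1) ^ ∑ n_i` (`nestedValue_bernoulli'`).

For Raabe's value, the mean of the Bernoulli polynomial `B_k` over `[c, c+1]` is `c ^ k`. Replacing
each `(1 + a_i) ^ k` by `B_k(1 + x_i)` thus inverts Raabe's identity, and at `x = 0` it gives
`B_k(1) = bernoulli' k`, the data of the series. The value is unique because `P(0)` is a linear
functional of the cube average of `P` (`bernoulliFunctional_cubeAverage`). -/

/-! ### Calculus and uniqueness of continuations. -/

theorem HasContinuation.congr {f f' : ℂ → ℂ} {p v : ℂ} (h : HasContinuation f p v) {σ : ℝ}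
    (hf : ∀ w : ℂ, σ < w.re → f w = f' w) : HasContinuation f' p v := by
  obtain ⟨g, σ', τ, hg, hm, hτ, ha, hv⟩ := h
  exact ⟨g, max σ σ', τ, fun w hw => (hg w ((le_max_right _ _).trans_lt hw)).trans
    (hf w ((le_max_left _ _).trans_lt hw)), hm, hτ, ha, hv⟩

theorem HasContinuation.add {f f' : ℂ → ℂ} {p v v' : ℂ} (h : HasContinuation f p v)
    (h' : HasContinuation f' p v') : HasContinuation (fun w => f w + f' w) p (v + v') := by
  obtain ⟨g, σ, τ, hg, hm, hτ, ha, hv⟩ := h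
  obtain ⟨g', σ', τ', hg', hm', hτ', ha', hv'⟩ := h'
  refine ⟨g + g', max σ σ', max τ τ', fun w hw => ?_, fun w hw => ?_, max_lt hτ hτ',
    ha.add ha', by simp [hv, hv']⟩
  · simp only [Pi.add_apply]
    rw [hg w ((le_max_left _ _).trans_lt hw), hg' w ((le_max_right _ _).trans_lt hw)]
  · have hw' : max τ τ' < w.re := hw
    exact (hm w ((le_max_left _ _).trans_lt hw')).add (hm' w ((le_max_right _ _).trans_lt hw'))

theorem HasContinuation.const_mul {f : ℂ → ℂ} {p v : ℂ} (h : HasContinuation f p v) (c : ℂ) :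
    HasContinuation (fun w => c * f w) p (c * v) := by
  obtain ⟨g, σ, τ, hg, hm, hτ, ha, hv⟩ := h
  refine ⟨fun w => c * g w, σ, τ, fun w hw => by simp only [hg w hw], fun w hw => ?_, hτ,
    analyticAt_const.mul ha, by simp only [hv]⟩
  exact (MeromorphicAt.const c w).mul (hm w hw)

theorem HasContinuation.zero (p : ℂ) : HasContinuation (fun _ => 0) p 0 :=
  ⟨fun _ => 0, 0, p.re - 1, fun _ _ => rfl, fun w _ => MeromorphicAt.const 0 w, by linarith,
    analyticAt_const, rfl⟩

theorem HasContinuation.sum {ι : Type*} {f : ι → ℂ → ℂ} {p : ℂ} {v : ι → ℂ} (t : Finset ι)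
    (h : ∀ i ∈ t, HasContinuation (f i) p (v i)) :
    HasContinuation (fun w => ∑ i ∈ t, f i w) p (∑ i ∈ t, v i) := by
  classical
  induction t using Finset.induction_on with
  | empty => simpa using HasContinuation.zero p
  | insert i t hi ih =>
    simp only [Finset.sum_insert hi]
    exact (h i (by simp)).add (ih fun j hj => h j (by simp [hj]))

theorem HasContinuation.comp_sub {f : ℂ → ℂ} {p v : ℂ} (c : ℂ)
    (h : HasContinuation f (p - c) v) : HasContinuation (fun w => f (w - c)) p v := by
  obtain ⟨g, σ, τ, hg, hm, hτ, ha, hv⟩ := h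
  have hsub : ∀ w : ℂ, AnalyticAt ℂ (fun w : ℂ => w - c) w := fun w => by fun_prop
  refine ⟨fun w => g (w - c), σ + c.re, τ + c.re, fun w hw => hg _ ?_, fun w hw => ?_, ?_,
    ha.comp_of_eq (hsub p) rfl, hv⟩
  · simp only [Complex.sub_re]; linarith
  · have hw' : τ < (w - c).re := by
      simp only [mem_ofPred_eq] at hw
      simp only [Complex.sub_re]; linarith
    exact (hm (w - c) hw').comp_analyticAt (f := g) (g := fun w => w - c) (hsub w)
  · simp only [Complex.sub_re] at hτ; linarith

/-- A meromorphic function on a half-plane that vanishes far to the right vanishes wherever it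
is analytic. -/
theorem MeromorphicOn.eq_zero_of_halfPlane {g : ℂ → ℂ} {σ τ : ℝ} {p : ℂ}
    (hg : MeromorphicOn g {w : ℂ | τ < w.re}) (h0 : ∀ w : ℂ, σ < w.re → g w = 0)
    (hp : τ < p.re) (ha : AnalyticAt ℂ g p) : g p = 0 := by
  have hconn : IsPreconnected {w : ℂ | τ < w.re} := (convex_halfSpace_re_gt τ).isPreconnected
  -- `g` vanishes near `q`, so it has infinite order there; infinite order spreads over the
  -- connected half-plane to `p`, and analyticity at `p` turns vanishing on a punctured
  -- neighbourhood into `g p = 0`.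
  set q : ℂ := ((max σ τ + 1 : ℝ) : ℂ) with hq
  have hqσ : σ < q.re := by
    rw [hq, Complex.ofReal_re]; linarith [le_max_left σ τ]
  have hqτ : τ < q.re := by
    rw [hq, Complex.ofReal_re]; linarith [le_max_right σ τ]
  have hqtop : meromorphicOrderAt g q = ⊤ := by
    rw [meromorphicOrderAt_eq_top_iff]
    refine Filter.Eventually.filter_mono nhdsWithin_le_nhds ?_
    filter_upwards [(isOpen_lt continuous_const Complex.continuous_re).mem_nhds hqσ] with w hw
    exact h0 w hw
  have hptop : meromorphicOrderAt g p = ⊤ := by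
    by_contra hne
    exact hg.meromorphicOrderAt_ne_top_of_isPreconnected hconn hp hqτ hne hqtop
  rw [meromorphicOrderAt_eq_top_iff] at hptop
  exact tendsto_nhds_unique
    (ha.continuousAt.tendsto.mono_left nhdsWithin_le_nhds)
    (tendsto_const_nhds.congr' (hptop.mono fun w hw => hw.symm))

theorem HasContinuation.unique {f : ℂ → ℂ} {p v v' : ℂ} (h : HasContinuation f p v)
    (h' : HasContinuation f p v') : v = v' := by
  have H := h.add (h'.const_mul (-1))
  obtain ⟨g, σ, τ, hg, hm, hτ, ha, hv⟩ := H
  have := hm.eq_zero_of_halfPlane (σ := σ) (fun w hw => by rw [hg w hw]; ring) hτ ha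
  rw [hv] at this
  linear_combination this

theorem HasIteratedContinuation.congr {r : ℕ} {F F' : (Fin r → ℂ) → ℂ} {p : Fin r → ℂ} {v : ℂ}
    (h : HasIteratedContinuation r F p v) {A : ℝ}
    (hF : ∀ s : Fin r → ℂ, (∀ i, A < (s i).re) → F s = F' s) :
    HasIteratedContinuation r F' p v := by
  cases r with
  | zero => exact (hF p fun i => i.elim0).symm.trans h
  | succ r =>
    obtain ⟨G, ⟨B, hB⟩, hG⟩ := h
    refine ⟨G, ⟨max A B, fun s hs => ?_⟩, hG⟩
    refine (hB s fun i => (le_max_right _ _).trans_lt (hs i)).congr (σ := A) fun w hw => hF _ ?_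
    intro i
    induction i using Fin.lastCases with
    | last => simpa using hw
    | cast i => simpa using (le_max_left _ _).trans_lt (hs i)

theorem HasIteratedContinuation.unique {r : ℕ} {F : (Fin r → ℂ) → ℂ} {p : Fin r → ℂ} {v v' : ℂ}
    (h : HasIteratedContinuation r F p v) (h' : HasIteratedContinuation r F p v') : v = v' := by
  induction r with
  | zero => exact Eq.trans (Eq.symm h) h'
  | succ r ih =>
    obtain ⟨G, ⟨A, hA⟩, hG⟩ := h
    obtain ⟨G', ⟨A', hA'⟩, hG'⟩ := h'
    refine ih hG (hG'.congr (A := max A A') fun s hs => ?_)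
    exact (hA' s fun i => (le_max_right _ _).trans_lt (hs i)).unique
      (hA s fun i => (le_max_left _ _).trans_lt (hs i))

/-! ### Holomorphic dependence of integrals on a parameter. -/

/-- A locally uniformly dominated integral of holomorphic functions is holomorphic. -/
theorem differentiableOn_integral_of_dominated {α : Type*} [MeasurableSpace α] {μ : Measure α}
    {E : ℂ → α → ℂ} {U : Set ℂ} {bound : α → ℝ} (hU : IsOpen U)
    (hE : ∀ x, DifferentiableOn ℂ (fun w => E w x) U)
    (hmeas : ∀ w ∈ U, AEStronglyMeasurable (E w) μ)
    (hbound : ∀ w ∈ U, ∀ x, ‖E w x‖ ≤ bound x) (hint : Integrable bound μ) :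
    DifferentiableOn ℂ (fun w => ∫ x, E w x ∂μ) U := by
  intro w hw
  obtain ⟨ε, hε, hball⟩ := Metric.isOpen_iff.1 hU w hw
  have hmem : ∀ z ∈ Metric.ball w (ε / 2), Metric.closedBall z (ε / 4) ⊆ U := by
    intro z hz y hy
    apply hball
    rw [Metric.mem_ball] at hz ⊢
    rw [Metric.mem_closedBall] at hy
    linarith [dist_triangle y z w]
  have hderiv : ∀ x, ∀ z ∈ Metric.ball w (ε / 2),
      HasDerivAt (fun w => E w x) (deriv (fun w => E w x) z) z := fun x z hz =>
    ((hE x).differentiableAt (hU.mem_nhds (hmem z hz (Metric.mem_closedBall_self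
      (by positivity))))).hasDerivAt
  -- This sequence serves only to show that the derivative at `w` is measurable in `x`, as a limit
  -- of difference quotients.
  have hpt : ∀ n : ℕ, w + ((ε / (n + 2) : ℝ) : ℂ) ∈ U := by
    intro n
    apply hball
    rw [Metric.mem_ball, dist_eq_norm, add_sub_cancel_left, Complex.norm_real, Real.norm_eq_abs,
      abs_of_pos (by positivity)]
    exact div_lt_self hε (by linarith [n.cast_nonneg (α := ℝ)])
  have hlim : Tendsto (fun n : ℕ => w + ((ε / (n + 2) : ℝ) : ℂ)) atTop (𝓝[≠] w) := by
    rw [tendsto_nhdsWithin_iff]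
    constructor
    · have h1 : Tendsto (fun n : ℕ => ε / ((n : ℝ) + 2)) atTop (𝓝 0) :=
        tendsto_const_nhds.div_atTop (tendsto_atTop_add_const_right _ _
          tendsto_natCast_atTop_atTop)
      have h2 := (Complex.continuous_ofReal.tendsto 0).comp h1
      simpa using h2.const_add w
    · refine Eventually.of_forall fun n => ?_
      have : (ε / ((n : ℝ) + 2)) ≠ 0 := by positivity
      simpa using (by exact_mod_cast this : ((ε / ((n : ℝ) + 2) : ℝ) : ℂ) ≠ 0)
  refine (hasDerivAt_integral_of_dominated_loc_of_deriv_le (s := Metric.ball w (ε / 2))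
    (bound := fun x => bound x / (ε / 4)) (Metric.ball_mem_nhds w (by positivity)) ?_ ?_ ?_ ?_
    (hint.div_const _) (F' := fun z x => deriv (fun w => E w x) z)
    (Eventually.of_forall hderiv)).2.differentiableAt.differentiableWithinAt
  · filter_upwards [hU.mem_nhds hw] with z hz using hmeas z hz
  · exact hint.mono' (hmeas w hw) (Eventually.of_forall (hbound w hw))
  · refine aestronglyMeasurable_of_tendsto_ae atTop
      (f := fun (n : ℕ) x => slope (fun w => E w x) w (w + ((ε / (n + 2) : ℝ) : ℂ))) (fun n => ?_)
      (Eventually.of_forall fun x => ?_)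
    · simp only [slope_def_field]
      exact ((hmeas _ (hpt n)).sub (hmeas _ hw)).div₀ aestronglyMeasurable_const
    · exact (hasDerivAt_iff_tendsto_slope.1 (hderiv x w
        (Metric.mem_ball_self (by positivity)))).comp hlim
  -- Cauchy's estimate on the circle of radius `ε / 4` about `z` dominates the derivative.
  · refine Eventually.of_forall fun x z hz => ?_
    refine Complex.norm_deriv_le_of_forall_mem_sphere_norm_le (by positivity) ?_ fun y hy =>
      hbound y (hmem z hz (Metric.sphere_subset_closedBall hy)) x
    refine ((hE x).mono ((Metric.closure_ball_subset_closedBall).trans (hmem z hz))).diffContOnCl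

/-! ### The nested kernel and its integrable majorant. -/

theorem one_add_sum_le_prod_one_add_of_nonneg {ι : Type*} (t : Finset ι) {f : ι → ℝ}
    (hf : ∀ i, 0 ≤ f i) : 1 + ∑ i ∈ t, f i ≤ ∏ i ∈ t, (1 + f i) := by
  classical
  induction t using Finset.induction_on with
  | empty => simp
  | insert i t hi ih =>
    rw [Finset.sum_insert hi, Finset.prod_insert hi]
    nlinarith [mul_le_mul_of_nonneg_left ih (by linarith [hf i] : (0 : ℝ) ≤ 1 + f i),
      mul_nonneg (hf i) (Finset.sum_nonneg fun j (_ : j ∈ t) => hf j)]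

/-- The summand `∏_j y_j ^ (-s_j)`, where `y_1, …, y_r` are the partial sums of
`X_1 x_1, …, X_r x_r`. -/
noncomputable def nestedKernel {α : Type*} {r : ℕ} (X : Fin r → α → ℝ) (s : Fin r → ℂ)
    (x : Fin r → α) : ℂ :=
  ∏ j, ((∑ i ∈ Finset.Iic j, X i (x i) : ℝ) : ℂ) ^ (-s j)

theorem nestedKernel_snoc {α : Type*} {r : ℕ} (X : Fin (r + 1) → α → ℝ) (s : Fin r → ℂ) (w : ℂ)
    (x : Fin r → α) (t : α) :
    nestedKernel X (Fin.snoc s w) (Fin.snoc x t : Fin (r + 1) → α) =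
      nestedKernel (fun i => X i.castSucc) s x *
        ((∑ i, X i.castSucc (x i) + X (Fin.last r) t : ℝ) : ℂ) ^ (-w) := by
  have hI : (Finset.Iic (Fin.last r)) = Finset.univ := by
    ext i; simp [Fin.le_last]
  simp only [nestedKernel, Fin.prod_univ_castSucc, Fin.snoc_castSucc, Fin.snoc_last,
    Fin.sum_Iic_castSucc, hI, Fin.sum_univ_castSucc]

/-- The full sum is the base of the last factor, so a monomial weight is absorbed into the last
exponent. This reduces polynomial weights to the weight `1`. -/
theorem nestedKernel_mul_pow {r : ℕ} {X : Fin (r + 1) → α → ℝ} (hX : ∀ i x, 1 ≤ X i x)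
    (s : Fin r → ℂ) (w : ℂ) (k : ℕ) (x : Fin (r + 1) → α) :
    nestedKernel X (Fin.snoc s w) x * ((∑ i, X i (x i) : ℝ) : ℂ) ^ k =
      nestedKernel X (Fin.snoc s (w - k)) x := by
  obtain ⟨x, t, rfl⟩ : ∃ (x' : Fin r → α) (t : α), x = Fin.snoc x' t :=
    ⟨Fin.init x, x (Fin.last r), (Fin.snoc_init_self (α := fun _ => α) x).symm⟩
  have hpos : 0 < ∑ i : Fin r, X i.castSucc (x i) + X (Fin.last r) t :=
    add_pos_of_nonneg_of_pos (Finset.sum_nonneg fun i _ => by linarith [hX i.castSucc (x i)])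
      (by linarith [hX (Fin.last r) t])
  have hne : ((∑ i : Fin r, X i.castSucc (x i) + X (Fin.last r) t : ℝ) : ℂ) ≠ 0 := by
    exact_mod_cast hpos.ne'
  rw [nestedKernel_snoc, nestedKernel_snoc, Fin.sum_univ_castSucc]
  simp only [Fin.snoc_castSucc, Fin.snoc_last]
  rw [neg_sub, sub_eq_add_neg, add_comm (k : ℂ), Complex.cpow_add _ _ hne, Complex.cpow_natCast,
    mul_assoc]

/-- Each partial sum dominates its last term `X_j ≥ 1`. Of the `B + 2` powers available in each
variable, `B` pay for the polynomial growth, distributed over the variables, and two remain for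
integrability. -/
theorem norm_nestedKernel_mul_le {α : Type*} {r : ℕ} {X : Fin r → α → ℝ} (hX : ∀ i x, 1 ≤ X i x)
    {s : Fin r → ℂ} {B : ℕ} (hs : ∀ i, (B + 2 : ℝ) ≤ (s i).re) (x : Fin r → α) :
    ‖nestedKernel X s x‖ * (1 + ∑ i, X i (x i)) ^ B ≤
      ∏ i, (2 ^ B * ((X i (x i)) ^ 2)⁻¹) := by
  have h0 : ∀ i, 0 ≤ X i (x i) := fun i => by linarith [hX i (x i)]
  have h1 : (1 + ∑ i, X i (x i)) ^ B ≤ ∏ i, (1 + X i (x i)) ^ B := by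
    rw [Finset.prod_pow]
    exact pow_le_pow_left₀ (by linarith [Finset.sum_nonneg fun i (_ : i ∈ Finset.univ) => h0 i])
      (one_add_sum_le_prod_one_add_of_nonneg _ h0) B
  refine (mul_le_mul_of_nonneg_left h1 (norm_nonneg _)).trans ?_
  rw [nestedKernel, norm_prod, ← Finset.prod_mul_distrib]
  refine Finset.prod_le_prod (fun i _ => mul_nonneg (norm_nonneg _)
    (pow_nonneg (by linarith [h0 i]) _)) fun j _ => ?_
  set y := ∑ i ∈ Finset.Iic j, X i (x i)
  have hy : X j (x j) ≤ y :=
    Finset.single_le_sum (f := fun i => X i (x i)) (fun i _ => h0 i) (by simp)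
  have hX1 := hX j (x j)
  have hXpos : 0 < X j (x j) := by linarith
  have hypos : 0 < y := by linarith
  rw [Complex.norm_cpow_eq_rpow_re_of_pos hypos, Complex.neg_re, Real.rpow_neg hypos.le]
  have h2 : (X j (x j)) ^ (B + 2) ≤ y ^ (s j).re := by
    calc (X j (x j)) ^ (B + 2) ≤ y ^ (B + 2) := pow_le_pow_left₀ hXpos.le hy _
      _ = y ^ ((B + 2 : ℕ) : ℝ) := (Real.rpow_natCast _ _).symm
      _ ≤ y ^ (s j).re := Real.rpow_le_rpow_of_exponent_le (by linarith)
          (by push_cast; exact hs j)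
  have h3 : (1 + X j (x j)) ^ B ≤ (2 * X j (x j)) ^ B :=
    pow_le_pow_left₀ (by linarith) (by linarith) _
  calc (y ^ (s j).re)⁻¹ * (1 + X j (x j)) ^ B
      ≤ ((X j (x j)) ^ (B + 2))⁻¹ * (2 * X j (x j)) ^ B := by
        gcongr
    _ = 2 ^ B * ((X j (x j)) ^ 2)⁻¹ := by
        rw [pow_add, mul_pow]; field_simp

section

variable {α : Type*} [MeasurableSpace α]

theorem measurable_nestedKernel {r : ℕ} {X : Fin r → α → ℝ} (hX : ∀ i, Measurable (X i))
    (s : Fin r → ℂ) : Measurable (nestedKernel X s) := by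
  unfold nestedKernel
  refine Finset.measurable_prod _ fun j _ => ?_
  refine Measurable.pow_const ?_ _
  refine Complex.measurable_ofReal.comp ?_
  exact Finset.measurable_sum _ fun i _ => (hX i).comp (measurable_pi_apply i)

theorem integrable_nestedKernel_bound {μ : Measure α} [SigmaFinite μ] {r : ℕ} {X : Fin r → α → ℝ}
    (hint : ∀ i, Integrable (fun x => ((X i x) ^ 2)⁻¹) μ) (B : ℕ) :
    Integrable (fun x : Fin r → α => ∏ i, (2 ^ B * ((X i (x i)) ^ 2)⁻¹))
      (Measure.pi fun _ => μ) :=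
  Integrable.fintype_prod (f := fun i t => (2 ^ B * ((X i t) ^ 2)⁻¹ : ℝ))
    fun i => (hint i).const_mul _

theorem integrable_nestedKernel_mul {μ : Measure α} [SigmaFinite μ] {r : ℕ} {X : Fin r → α → ℝ}
    (hmeas : ∀ i, Measurable (X i)) (hX : ∀ i x, 1 ≤ X i x)
    (hint : ∀ i, Integrable (fun x => ((X i x) ^ 2)⁻¹) μ) {f : ℝ → ℂ} (hf : Measurable f)
    {C : ℝ} {B : ℕ} (hC : ∀ y, 0 ≤ y → ‖f y‖ ≤ C * (1 + y) ^ B) {s : Fin r → ℂ}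
    (hs : ∀ i, (B + 2 : ℝ) ≤ (s i).re) :
    Integrable (fun x => nestedKernel X s x * f (∑ i, X i (x i))) (Measure.pi fun _ => μ) := by
  refine ((integrable_nestedKernel_bound hint B).const_mul C).mono' ?_
    (Eventually.of_forall fun x => ?_)
  · exact ((measurable_nestedKernel hmeas s).mul (hf.comp (Finset.measurable_sum _ fun i _ =>
      (hmeas i).comp (measurable_pi_apply i)))).aestronglyMeasurable
  · have h0 : 0 ≤ ∑ i, X i (x i) := Finset.sum_nonneg fun i _ => by linarith [hX i (x i)]
    have hC0 : 0 ≤ C := by simpa using (norm_nonneg _).trans (hC 0 le_rfl)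
    rw [norm_mul]
    calc ‖nestedKernel X s x‖ * ‖f (∑ i, X i (x i))‖
        ≤ ‖nestedKernel X s x‖ * (C * (1 + ∑ i, X i (x i)) ^ B) := by gcongr; exact hC _ h0
      _ = C * (‖nestedKernel X s x‖ * (1 + ∑ i, X i (x i)) ^ B) := by ring
      _ ≤ _ := by gcongr; exact norm_nestedKernel_mul_le hX hs x

end

/-! ### Appell polynomials and the regularized value. -/

/-- The polynomial `∑_k (m choose k) β_k x ^ (m - k)`. -/
noncomputable def appellPolynomial (β : ℕ → ℂ) (m : ℕ) : ℂ[X] :=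
  ∑ k ∈ Finset.range (m + 1), Polynomial.monomial (m - k) ((m.choose k : ℂ) * β k)

theorem eval_appellPolynomial (β : ℕ → ℂ) (m : ℕ) (y : ℂ) :
    (appellPolynomial β m).eval y =
      ∑ k ∈ Finset.range (m + 1), (m.choose k : ℂ) * β k * y ^ (m - k) := by
  simp [appellPolynomial, Polynomial.eval_finsetSum, Polynomial.eval_monomial]

/-- The linear map that sends `x ^ n` to `-1 / (n + 1)` times the Appell polynomial of degree
`n + 1`: the regularized value of a divergent sum or integral of `x ^ n`. -/
noncomputable def regularizedTail (β : ℕ → ℂ) : ℂ[X] →ₗ[ℂ] ℂ[X] :=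
  Polynomial.lsum fun n =>
    LinearMap.toSpanSingleton ℂ ℂ[X] ((-1 / (n + 1 : ℂ)) • appellPolynomial β (n + 1))

theorem regularizedTail_X_pow (β : ℕ → ℂ) (n : ℕ) :
    regularizedTail β (Polynomial.X ^ n) = (-1 / (n + 1 : ℂ)) • appellPolynomial β (n + 1) := by
  rw [regularizedTail, Polynomial.lsum_apply, ← Polynomial.monomial_one_right_eq_X_pow,
    Polynomial.sum_monomial_index _ _ (by simp)]
  simp

/-- The value at `(-n_1, …, -n_r)` obtained by regularizing one variable at a time. -/
noncomputable def nestedValue : (r : ℕ) → (Fin r → ℕ) → (Fin r → ℕ → ℂ) → ℂ[X] → ℂ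
  | 0, _, _, Q => Q.eval 0
  | r + 1, n, β, Q => nestedValue r (fun i => n i.castSucc) (fun i => β i.castSucc)
      (regularizedTail (β (Fin.last r)) (Polynomial.X ^ n (Fin.last r) * Q))

theorem exists_norm_eval_le (Q : ℂ[X]) :
    ∃ C : ℝ, ∃ B : ℕ, ∀ y : ℝ, 0 ≤ y → ‖Q.eval (y : ℂ)‖ ≤ C * (1 + y) ^ B := by
  refine ⟨∑ k ∈ Finset.range (Q.natDegree + 1), ‖Q.coeff k‖, Q.natDegree, fun y hy => ?_⟩
  rw [Polynomial.eval_eq_sum_range, Finset.sum_mul]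
  refine (norm_sum_le _ _).trans (Finset.sum_le_sum fun k hk => ?_)
  rw [norm_mul, norm_pow, Complex.norm_real, Real.norm_of_nonneg hy]
  have hk' : k ≤ Q.natDegree := by simpa [Nat.lt_succ_iff] using hk
  gcongr
  exact (pow_le_pow_left₀ hy (by linarith) k).trans (pow_le_pow_right₀ (by linarith) hk')

/-! ### Continuation of nested integrals, one variable at a time. -/

section

variable {α : Type*} [MeasurableSpace α]

/-- `∫ (y + X) ^ (-w) dμ` has a continuation of polynomial growth in `y`, with the values
prescribed by `β` at the non-positive integers. -/
structure HasRegularizedTail (μ : Measure α) (S : AddSubmonoid ℝ) (X : α → ℝ) (β : ℕ → ℂ) :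
    Prop where
  measurable : Measurable X
  one_le : ∀ x, 1 ≤ X x
  mem : ∀ x, X x ∈ S
  integrable : Integrable (fun x => ((X x) ^ 2)⁻¹) μ
  exists_continuation : ∃ (u v : ℂ → ℂ) (e : ℂ → ℝ → ℂ),
    -- All poles sit in `u` and `v`, which do not depend on `y`; the `y`-dependence is in the entire
    -- factor `e`, which can be integrated over the remaining variables. The identities are asked
    -- only on `S`, since for the series they hold at integers `y` only.
    (∀ w, MeromorphicAt u w) ∧ (∀ w, MeromorphicAt v w) ∧
    (∀ n : ℕ, AnalyticAt ℂ u (-n)) ∧ (∀ n : ℕ, AnalyticAt ℂ v (-n)) ∧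
    (∀ y, 0 ≤ y → Differentiable ℂ fun w => e w y) ∧ (∀ w, Measurable (e w)) ∧
    (∀ T : ℝ, ∃ (C : ℝ) (B : ℕ), ∀ w : ℂ, T < w.re → ∀ y, 0 ≤ y → ‖e w y‖ ≤ C * (1 + y) ^ B) ∧
    (∀ w : ℂ, 2 < w.re → ∀ y ∈ S, 0 ≤ y →
      ∫ x, ((y + X x : ℝ) : ℂ) ^ (-w) ∂μ = u w + v w * e w y) ∧
    ∀ n : ℕ, ∀ y ∈ S, 0 ≤ y →
      u (-n) + v (-n) * e (-n) y = (regularizedTail β (Polynomial.X ^ n)).eval (y : ℂ)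

/-- The integral of `∏_j y_j ^ (-s_j) * Q(y_r)`, where `y_1, …, y_r` are the partial sums of
`X_1 x_1, …, X_r x_r`. -/
noncomputable def nestedIntegral (μ : Measure α) {r : ℕ} (X : Fin r → α → ℝ) (Q : ℂ[X])
    (s : Fin r → ℂ) : ℂ :=
  ∫ x, nestedKernel X s x * Q.eval ((∑ i, X i (x i) : ℝ) : ℂ) ∂(Measure.pi fun _ => μ)

variable {μ : Measure α} [SigmaFinite μ] {S : AddSubmonoid ℝ}

theorem integral_pi_snoc {r : ℕ} {f : (Fin (r + 1) → α) → ℂ}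
    (hf : Integrable f (Measure.pi fun _ => μ)) :
    ∫ x, f x ∂(Measure.pi fun _ => μ) =
      ∫ x, ∫ t, f (Fin.snoc x t) ∂μ ∂(Measure.pi fun _ : Fin r => μ) := by
  have hmp := (measurePreserving_piFinSuccAbove (fun _ : Fin (r + 1) => μ) (Fin.last r)).symm
  have h1 := hmp.integral_comp' f
  have h2 := (hmp.integrable_comp_emb (MeasurableEquiv.measurableEmbedding _)).2 hf
  rw [← h1]
  refine (integral_prod_symm _ h2).trans ?_
  refine integral_congr_ae (Eventually.of_forall fun x => ?_)
  refine integral_congr_ae (Eventually.of_forall fun t => ?_)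
  simp only [Function.comp, MeasurableEquiv.piFinSuccAbove_symm_apply, Fin.insertNthEquiv,
    Equiv.coe_fn_mk, Fin.insertNth_last']

theorem eventually_integrable_nestedIntegral {r : ℕ} {X : Fin r → α → ℝ} {β : Fin r → ℕ → ℂ}
    (h : ∀ i, HasRegularizedTail μ S (X i) (β i)) (Q : ℂ[X]) :
    ∀ᶠ A : ℝ in atTop, ∀ s : Fin r → ℂ, (∀ i, A < (s i).re) →
      Integrable (fun x => nestedKernel X s x * Q.eval ((∑ i, X i (x i) : ℝ) : ℂ))
        (Measure.pi fun _ => μ) := by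
  obtain ⟨C, B, hC⟩ := exists_norm_eval_le Q
  filter_upwards [eventually_ge_atTop (B + 2 : ℝ)] with A hA s hs
  exact integrable_nestedKernel_mul (f := fun y => Q.eval (y : ℂ)) (fun i => (h i).measurable)
    (fun i => (h i).one_le) (fun i => (h i).integrable)
    (Q.continuous.measurable.comp Complex.measurable_ofReal) hC fun i => hA.trans (hs i).le

theorem eventually_nestedIntegral_sum {r : ℕ} {X : Fin r → α → ℝ} {β : Fin r → ℕ → ℂ}
    (h : ∀ i, HasRegularizedTail μ S (X i) (β i)) {ι : Type*} (t : Finset ι) (c : ι → ℂ)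
    (Q : ι → ℂ[X]) :
    ∀ᶠ A : ℝ in atTop, ∀ s : Fin r → ℂ, (∀ i, A < (s i).re) →
      nestedIntegral μ X (∑ k ∈ t, c k • Q k) s = ∑ k ∈ t, c k * nestedIntegral μ X (Q k) s := by
  have H := (Filter.eventually_all_finset t).2 fun k (_ : k ∈ t) =>
    eventually_integrable_nestedIntegral h (Q k)
  filter_upwards [H] with A hA s hs
  simp only [nestedIntegral, ← integral_const_mul]
  rw [← integral_finsetSum _ fun k hk => (hA k hk s hs).const_mul _]
  congr 1
  ext x
  simp only [Polynomial.eval_finsetSum, Polynomial.eval_smul, smul_eq_mul, Finset.mul_sum]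
  exact Finset.sum_congr rfl fun k _ => by ring

/-- By Fubini the last variable is integrated first, giving `u w + v w * e w y`. The outer integral
of the kernel against `e w` stays holomorphic in `w` once the other exponents have real part large
enough to beat the growth of `e`. -/
theorem eventually_hasContinuation_nestedIntegral_one {r : ℕ} {X : Fin (r + 1) → α → ℝ}
    {β : Fin (r + 1) → ℕ → ℂ} (h : ∀ i, HasRegularizedTail μ S (X i) (β i)) (n : ℕ) :
    ∀ᶠ A : ℝ in atTop, ∀ s : Fin r → ℂ, (∀ i, A < (s i).re) →
      HasContinuation (fun w => nestedIntegral μ X 1 (Fin.snoc s w)) (-n)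
        (nestedIntegral μ (fun i : Fin r => X i.castSucc)
          (regularizedTail (β (Fin.last r)) (Polynomial.X ^ n)) s) := by
  obtain ⟨u, v, e, hu, hv, hun, hvn, hed, hem, heb, heq, hval⟩ :=
    (h (Fin.last r)).exists_continuation
  -- The growth exponent is fixed for the whole half-plane `re w > -n - 1`, before `s` is chosen, so
  -- one threshold on `s` serves every `w`.
  obtain ⟨C, B, hCB⟩ := heb (-n - 1)
  filter_upwards [eventually_ge_atTop (B + 2 : ℝ)] with A hA s hs
  have hsB : ∀ i, (B + 2 : ℝ) ≤ (s i).re := fun i => hA.trans (hs i).le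
  set X' : Fin r → α → ℝ := fun i => X i.castSucc with hX'
  have hX'm : ∀ i, Measurable (X' i) := fun i => (h _).measurable
  have hX'1 : ∀ i x, 1 ≤ X' i x := fun i => (h _).one_le
  have hX'i : ∀ i, Integrable (fun x => ((X' i x) ^ 2)⁻¹) μ := fun i => (h _).integrable
  have h0 : ∀ x : Fin r → α, 0 ≤ ∑ i, X' i (x i) := fun x =>
    Finset.sum_nonneg fun i _ => by linarith [hX'1 i (x i)]
  have hS : ∀ x : Fin r → α, ∑ i, X' i (x i) ∈ S := fun x => sum_mem fun i _ => (h _).mem _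
  have hI0 : Integrable (nestedKernel X' s) (Measure.pi fun _ => μ) := by
    have := integrable_nestedKernel_mul hX'm hX'1 hX'i (f := fun _ => 1) measurable_const
      (C := 1) (B := 0) (s := s) (by simp) fun i => by
        have := hsB i
        push_cast
        linarith [B.cast_nonneg (α := ℝ)]
    simpa using this
  have hIe : ∀ w : ℂ, (-n - 1 : ℝ) < w.re → Integrable
      (fun x => nestedKernel X' s x * e w (∑ i, X' i (x i))) (Measure.pi fun _ => μ) :=
    fun w hw => integrable_nestedKernel_mul hX'm hX'1 hX'i (hem w) (hCB w hw) hsB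
  have hcomb : ∀ w : ℂ, (-n - 1 : ℝ) < w.re →
      ∫ x, nestedKernel X' s x * (u w + v w * e w (∑ i, X' i (x i))) ∂(Measure.pi fun _ => μ) =
      u w * ∫ x, nestedKernel X' s x ∂(Measure.pi fun _ => μ) +
      v w * ∫ x, nestedKernel X' s x * e w (∑ i, X' i (x i)) ∂(Measure.pi fun _ => μ) := by
    intro w hw
    rw [← integral_const_mul, ← integral_const_mul,
      ← integral_add (hI0.const_mul _) ((hIe w hw).const_mul _)]
    congr 1
    ext x
    ring
  have hopen : IsOpen {w : ℂ | (-n - 1 : ℝ) < w.re} :=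
    isOpen_lt continuous_const Complex.continuous_re
  have hdiff : DifferentiableOn ℂ
      (fun w => ∫ x, nestedKernel X' s x * e w (∑ i, X' i (x i)) ∂(Measure.pi fun _ => μ))
      {w : ℂ | (-n - 1 : ℝ) < w.re} := by
    refine differentiableOn_integral_of_dominated hopen
      (bound := fun x => C * ∏ i, (2 ^ B * ((X' i (x i)) ^ 2)⁻¹))
      (fun x => ((hed _ (h0 x)).const_mul _).differentiableOn)
      (fun w hw => (hIe w hw).aestronglyMeasurable) (fun w hw x => ?_)
      ((integrable_nestedKernel_bound hX'i B).const_mul C)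
    have hC0 : 0 ≤ C := by simpa using (norm_nonneg _).trans (hCB w hw 0 le_rfl)
    rw [norm_mul]
    calc ‖nestedKernel X' s x‖ * ‖e w (∑ i, X' i (x i))‖
        ≤ ‖nestedKernel X' s x‖ * (C * (1 + ∑ i, X' i (x i)) ^ B) := by
          gcongr; exact hCB w hw _ (h0 x)
      _ = C * (‖nestedKernel X' s x‖ * (1 + ∑ i, X' i (x i)) ^ B) := by ring
      _ ≤ _ := by gcongr; exact norm_nestedKernel_mul_le hX'1 hsB x
  have hp : ((-n : ℂ)) ∈ {w : ℂ | (-n - 1 : ℝ) < w.re} := by simp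
  refine ⟨fun w => u w * ∫ x, nestedKernel X' s x ∂(Measure.pi fun _ => μ) +
      v w * ∫ x, nestedKernel X' s x * e w (∑ i, X' i (x i)) ∂(Measure.pi fun _ => μ),
    2, -n - 1, fun w hw => ?_, fun w hw => ?_, by simp, ?_, ?_⟩
  · have hw' : (-n - 1 : ℝ) < w.re := by linarith [n.cast_nonneg (α := ℝ)]
    refine (hcomb w hw').symm.trans ?_
    simp only [nestedIntegral]
    simp only [Polynomial.eval_one, mul_one]
    rw [integral_pi_snoc]
    · refine integral_congr_ae (Eventually.of_forall fun x => ?_)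
      simp only [nestedKernel_snoc, integral_const_mul]
      rw [← heq w hw _ (hS x) (h0 x)]
    · have := integrable_nestedKernel_mul (fun i => (h i).measurable) (fun i => (h i).one_le)
        (fun i => (h i).integrable) (f := fun _ => 1) measurable_const
        (C := 1) (B := 0) (s := Fin.snoc s w) (by simp) fun i => by
          induction i using Fin.lastCases with
          | last => simpa using hw.le
          | cast i =>
            have := hsB i
            simp only [Fin.snoc_castSucc, Nat.cast_zero]
            linarith [B.cast_nonneg (α := ℝ)]
      simpa using this
  · exact ((hu w).mul (MeromorphicAt.const _ _)).add
      ((hv w).mul (hdiff.analyticAt (hopen.mem_nhds hw)).meromorphicAt)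
  · exact ((hun n).mul analyticAt_const).add
      ((hvn n).mul (hdiff.analyticAt (hopen.mem_nhds hp)))
  · refine (hcomb _ hp).symm.trans ?_
    rw [nestedIntegral]
    refine integral_congr_ae (Eventually.of_forall fun x => ?_)
    simp only [hval n _ (hS x) (h0 x)]

theorem eventually_hasContinuation_nestedIntegral {r : ℕ} {X : Fin (r + 1) → α → ℝ}
    {β : Fin (r + 1) → ℕ → ℂ} (h : ∀ i, HasRegularizedTail μ S (X i) (β i)) (n : ℕ) (Q : ℂ[X]) :
    ∀ᶠ A : ℝ in atTop, ∀ s : Fin r → ℂ, (∀ i, A < (s i).re) →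
      HasContinuation (fun w => nestedIntegral μ X Q (Fin.snoc s w)) (-n)
        (nestedIntegral μ (fun i : Fin r => X i.castSucc)
          (regularizedTail (β (Fin.last r)) (Polynomial.X ^ n * Q)) s) := by
  set t := Finset.range (Q.natDegree + 1) with ht
  have H1 := (Filter.eventually_all_finset t).2 fun k (_ : k ∈ t) =>
    eventually_hasContinuation_nestedIntegral_one h (n + k)
  have hQ : Q = ∑ k ∈ t, Q.coeff k • Polynomial.X ^ k := by
    conv_lhs => rw [Polynomial.as_sum_range_C_mul_X_pow Q]
    simp only [ht, Polynomial.smul_eq_C_mul]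
  have hL : regularizedTail (β (Fin.last r)) (Polynomial.X ^ n * Q) =
      ∑ k ∈ t, Q.coeff k • regularizedTail (β (Fin.last r)) (Polynomial.X ^ (n + k)) := by
    conv_lhs => rw [hQ]
    simp only [Finset.mul_sum, map_sum, mul_smul_comm, ← pow_add, map_smul]
  have H2 := eventually_nestedIntegral_sum (fun i : Fin r => h i.castSucc) t Q.coeff
    fun k => regularizedTail (β (Fin.last r)) (Polynomial.X ^ (n + k))
  obtain ⟨A₀, hA₀⟩ := (eventually_nestedIntegral_sum h t Q.coeff
    fun k => (Polynomial.X ^ k : ℂ[X])).exists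
  filter_upwards [H1, H2, eventually_ge_atTop A₀] with A hA1 hA2 hA3 s hs
  rw [hL, hA2 s hs]
  -- The monomial of degree `k` in `Q` shifts `w` to `w - k`, so its value at `-n` is the weight-one
  -- value at `-(n + k)`.
  refine (HasContinuation.sum t (f := fun k w => Q.coeff k * nestedIntegral μ X 1
    (Fin.snoc s (w - k))) fun k hk =>
    (HasContinuation.comp_sub (f := fun w => nestedIntegral μ X 1 (Fin.snoc s w)) (k : ℂ)
      (?_)).const_mul _).congr (σ := A₀) fun w hw => ?_
  · have := hA1 k hk s hs
    push_cast at this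
    rwa [neg_add] at this
  · conv_rhs => rw [hQ]
    rw [hA₀ (Fin.snoc s w) fun i => by
      induction i using Fin.lastCases with
      | last => simpa using hw
      | cast i => simpa using hA3.trans_lt (hs i)]
    refine Finset.sum_congr rfl fun k _ => ?_
    simp only [nestedIntegral, Polynomial.eval_pow, Polynomial.eval_X, Polynomial.eval_one,
      mul_one, nestedKernel_mul_pow fun i => (h i).one_le]

theorem hasIteratedContinuation_nestedIntegral {r : ℕ} {X : Fin r → α → ℝ} {β : Fin r → ℕ → ℂ}
    (h : ∀ i, HasRegularizedTail μ S (X i) (β i)) (n : Fin r → ℕ) (Q : ℂ[X]) :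
    HasIteratedContinuation r (nestedIntegral μ X Q) (fun i => -(n i : ℂ))
      (nestedValue r n β Q) := by
  induction r generalizing Q with
  | zero => simp [HasIteratedContinuation, nestedIntegral, nestedValue, nestedKernel, Measure.real]
  | succ r ih =>
    exact ⟨_, (eventually_hasContinuation_nestedIntegral h (n (Fin.last r)) Q).exists,
      ih (fun i => h i.castSucc) (fun i => n i.castSucc) _⟩

end

/-! ### Expansion of the nested value over tuples. -/

theorem Fin.sum_Ici_castSucc_eq {M : Type*} [AddCommMonoid M] {r : ℕ} (f : Fin (r + 1) → M)
    (j : Fin r) : ∑ i ∈ Finset.Ici j.castSucc, f i =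
      ∑ i ∈ Finset.Ici j, f i.castSucc + f (Fin.last r) := by
  have h1 : Finset.Ici j.castSucc = Finset.univ.filter (j.castSucc ≤ ·) := by ext; simp
  have h2 : Finset.Ici j = Finset.univ.filter (j ≤ ·) := by ext; simp
  rw [h1, h2, Finset.sum_filter, Finset.sum_filter, Fin.sum_univ_castSucc]
  simp [Fin.le_last]

theorem Fin.sum_Ioi_castSucc_eq {M : Type*} [AddCommMonoid M] {r : ℕ} (f : Fin (r + 1) → M)
    (j : Fin r) : ∑ i ∈ Finset.Ioi j.castSucc, f i =
      ∑ i ∈ Finset.Ioi j, f i.castSucc + f (Fin.last r) := by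
  have h1 : Finset.Ioi j.castSucc = Finset.univ.filter (j.castSucc < ·) := by ext; simp
  have h2 : Finset.Ioi j = Finset.univ.filter (j < ·) := by ext; simp
  rw [h1, h2, Finset.sum_filter, Finset.sum_filter, Fin.sum_univ_castSucc]
  simp [Fin.castSucc_lt_last]

theorem faulhaberUpper_castSucc {r : ℕ} (n k : Fin (r + 1) → ℕ) (j : Fin r) :
    faulhaberUpper n k j.castSucc =
      faulhaberUpper (fun i => n i.castSucc) (fun i => k i.castSucc) j +
        (n (Fin.last r) + 1 - k (Fin.last r)) := by
  simp only [faulhaberUpper, Fin.sum_Ici_castSucc_eq, Fin.sum_Ioi_castSucc_eq, Fin.val_castSucc]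
  push_cast
  ring

theorem faulhaberUpper_last {r : ℕ} (n k : Fin (r + 1) → ℕ) :
    faulhaberUpper n k (Fin.last r) = n (Fin.last r) + 1 := by
  have h1 : Finset.Ici (Fin.last r) = {Fin.last r} := by ext; simp [Fin.last_le_iff]
  have h2 : Finset.Ioi (Fin.last r) = ∅ := by ext i; simp [Fin.le_last]
  simp [faulhaberUpper, h1, h2]

theorem nestedValue_sum {r : ℕ} (n : Fin r → ℕ) (β : Fin r → ℕ → ℂ) {ι : Type*} (t : Finset ι)
    (c : ι → ℂ) (Q : ι → ℂ[X]) :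
    nestedValue r n β (∑ k ∈ t, c k • Q k) = ∑ k ∈ t, c k * nestedValue r n β (Q k) := by
  induction r generalizing Q with
  | zero => simp [nestedValue, Polynomial.eval_finsetSum]
  | succ r ih =>
    simp only [nestedValue, Finset.mul_sum, map_sum, mul_smul_comm, map_smul]
    exact ih _ _ _

/-- The tuples that contribute to the regularized value of `i_1 ^ n_1 ⋯ i_r ^ (n_r + q)`. -/
def shiftedConstantTuples {r : ℕ} (n : Fin r → ℕ) (q : ℕ) : Finset (Fin r → ℕ) :=
  {k ∈ Finset.piAntidiag Finset.univ (∑ i, n i + r + q) |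
    ∀ j, (k j : ℤ) ≤ faulhaberUpper n k j + q}

/-- The exponent `q` makes the induction work: choosing `k_r = l` in the last Appell polynomial
passes the power `n_r + q + 1 - l` to the remaining variables, which is the shift in
`faulhaberUpper_castSucc`. With no variables left, evaluation at `0` kills every `q ≠ 0`. -/
theorem nestedValue_X_pow {r : ℕ} (n : Fin r → ℕ) (β : Fin r → ℕ → ℂ) (q : ℕ) :
    nestedValue r n β (Polynomial.X ^ q) = ∑ k ∈ shiftedConstantTuples n q,
      ∏ j, (-(((Ring.choose (faulhaberUpper n k j + q) (k j) : ℤ) : ℂ) *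
        (β j (k j) / ((faulhaberUpper n k j + q : ℤ) : ℂ)))) := by
  induction r generalizing q with
  | zero =>
    rcases Nat.eq_zero_or_pos q with rfl | hq
    · have h : shiftedConstantTuples (r := 0) n 0 = {0} := by
        ext k; simp [shiftedConstantTuples, Subsingleton.elim k 0]
      simp [nestedValue, h]
    · have h : shiftedConstantTuples (r := 0) n q = ∅ := by
        ext k
        simp [shiftedConstantTuples, hq.ne]
      simp [nestedValue, h, hq.ne']
  | succ r ih =>
    set N := n (Fin.last r) with hN
    have hL : regularizedTail (β (Fin.last r)) (Polynomial.X ^ N * Polynomial.X ^ q) =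
        ∑ l ∈ Finset.range (N + q + 2),
          (-1 / ((N + q : ℕ) + 1 : ℂ) * (((N + q + 1).choose l : ℂ) * β (Fin.last r) l)) •
            (Polynomial.X ^ (N + q + 1 - l) : ℂ[X]) := by
      rw [← pow_add, regularizedTail_X_pow, appellPolynomial, Finset.smul_sum]
      refine Finset.sum_congr rfl fun l _ => ?_
      rw [mul_smul, ← Polynomial.C_mul_X_pow_eq_monomial, ← Polynomial.smul_eq_C_mul]
    rw [nestedValue, hL, nestedValue_sum]
    simp only [ih, Finset.mul_sum]
    rw [Finset.sum_sigma']
    refine Finset.sum_bij' (fun x _ => (Fin.snoc x.2 x.1 : Fin (r + 1) → ℕ))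
      (fun k _ => ⟨k (Fin.last r), fun i => k i.castSucc⟩) ?_ ?_ ?_ ?_ ?_
    · rintro ⟨l, k⟩ h
      simp only [Finset.mem_sigma, Finset.mem_range, shiftedConstantTuples, Finset.mem_filter,
        Finset.mem_piAntidiag, Finset.mem_univ, implies_true, and_true] at h ⊢
      obtain ⟨hl, hk, hj⟩ := h
      refine ⟨?_, fun j => ?_⟩
      · rw [Fin.sum_univ_castSucc, Fin.sum_univ_castSucc]
        simp only [Fin.snoc_castSucc, Fin.snoc_last]
        change ∑ i, k i = _ at hk
        omega
      · induction j using Fin.lastCases with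
        | last => rw [faulhaberUpper_last]; simp only [Fin.snoc_last]; omega
        | cast j =>
          rw [faulhaberUpper_castSucc]
          simp only [Fin.snoc_castSucc, Fin.snoc_last]
          have : (k j : ℤ) ≤ faulhaberUpper (fun i => n i.castSucc) (fun i => k i) j + _ := hj j
          omega
    · intro k h
      simp only [Finset.mem_sigma, Finset.mem_range, shiftedConstantTuples, Finset.mem_filter,
        Finset.mem_piAntidiag, Finset.mem_univ, implies_true, and_true] at h ⊢
      obtain ⟨hk, hj⟩ := h
      have hlast := hj (Fin.last r)
      rw [faulhaberUpper_last] at hlast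
      refine ⟨by omega, ?_, fun j => ?_⟩
      · rw [Fin.sum_univ_castSucc, Fin.sum_univ_castSucc] at hk
        omega
      · have := hj j.castSucc
        rw [faulhaberUpper_castSucc] at this
        omega
    · rintro ⟨l, k⟩ _
      simp
    · intro k _
      exact Fin.snoc_init_self k
    · rintro ⟨l, k⟩ h
      simp only [Finset.mem_sigma, Finset.mem_range] at h
      have hl : l ≤ N + q + 1 := by omega
      rw [Fin.prod_univ_castSucc, mul_comm]
      congr 1
      · refine Finset.prod_congr rfl fun j _ => ?_
        rw [faulhaberUpper_castSucc]
        simp only [Fin.snoc_castSucc, Fin.snoc_last]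
        -- `hl` makes the natural subtraction exact.
        have : ((N + q + 1 - l : ℕ) : ℤ) = N + 1 - l + q := by omega
        rw [this, add_assoc]
      · rw [faulhaberUpper_last]
        simp only [Fin.snoc_last]
        have : ((N : ℤ) + 1 + q) = ((N + q + 1 : ℕ) : ℤ) := by push_cast; ring
        rw [← hN, this, Ring.choose_natCast]
        push_cast
        ring

theorem nestedValue_one {r : ℕ} (n : Fin r → ℕ) (β : Fin r → ℕ → ℂ) :
    nestedValue r n β 1 = ∑ k ∈ constantTuples n,
      (∏ j, (-(((Ring.choose (faulhaberUpper n k j) (k j) : ℤ) : ℂ) /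
        ((faulhaberUpper n k j : ℤ) : ℂ)))) * ∏ j, β j (k j) := by
  have h := nestedValue_X_pow n β 0
  have hS : shiftedConstantTuples n 0 = constantTuples n := by
    simp [shiftedConstantTuples, constantTuples]
  rw [pow_zero, hS] at h
  rw [h]
  refine Finset.sum_congr rfl fun k _ => ?_
  rw [← Finset.prod_mul_distrib]
  refine Finset.prod_congr rfl fun j _ => ?_
  simp only [Nat.cast_zero, add_zero]
  ring

theorem nestedValue_bernoulli' {r : ℕ} (n : Fin r → ℕ) :
    (-1) ^ (∑ i, n i) * nestedValue r n (fun _ k => ((bernoulli' k : ℚ) : ℂ)) 1 =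
      (formalConstantTerm n : ℂ) := by
  rw [nestedValue_one, formalConstantTerm, Rat.cast_sum, Finset.mul_sum]
  refine Finset.sum_congr rfl fun k hk => ?_
  have hsum : ∑ i, k i = ∑ i, n i + r := by
    simp only [constantTuples, Finset.mem_filter, Finset.mem_piAntidiag] at hk
    exact hk.1.1
  -- Since `∑ k_j = ∑ n_j + r`, the exponents `k_j + 1` add up to `∑ n_j + 2r`. In each factor,
  -- `(-1) ^ k_j` turns `bernoulli'` into `bernoulli` and the extra `-1` cancels the regularization
  -- sign.
  have h1 : ((-1 : ℂ)) ^ (∑ i, n i) = ∏ j : Fin r, (-1) ^ (k j + 1) := by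
    rw [Finset.prod_pow_eq_pow_sum, Finset.sum_add_distrib, hsum]
    simp only [Finset.sum_const, Finset.card_univ, Fintype.card_fin, smul_eq_mul, mul_one]
    rw [add_assoc, pow_add, ← two_mul, pow_mul (-1 : ℂ) 2 r]
    simp
  rw [h1, faulhaberCoeff, ← Finset.prod_mul_distrib, ← Finset.prod_mul_distrib, Rat.cast_prod]
  refine Finset.prod_congr rfl fun j _ => ?_
  rw [bernoulli'_eq_bernoulli]
  have h2 : ((-1 : ℂ)) ^ (k j) * (-1) ^ (k j) = 1 := by rw [← mul_pow]; simp
  push_cast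
  rw [pow_succ]
  linear_combination ((Ring.choose (faulhaberUpper n k j) (k j) : ℤ) : ℂ) /
        ((faulhaberUpper n k j : ℤ) : ℂ) * ((bernoulli (k j) : ℚ) : ℂ) * h2

/-! ### The two instances: counting measure and Lebesgue measure. -/

/-- For integer `p`, the tail `∑_{m > p} m ^ (-w)` is `ζ(w)` minus a finite sum, which is entire in
`w`. The floor extends that finite sum to real `y`. -/
theorem hasRegularizedTail_nat :
    HasRegularizedTail (Measure.count : Measure ℕ)
      (AddMonoidHom.mrange (Nat.castAddMonoidHom ℝ)) (fun m : ℕ => ((m + 1 : ℕ) : ℝ))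
      (fun k => ((bernoulli' k : ℚ) : ℂ)) := by
  have hsum : ∀ w : ℂ, 2 < w.re → Summable fun m : ℕ => (m : ℂ) ^ (-w) := by
    intro w hw
    have := Complex.summable_one_div_nat_cpow.2 (show 1 < w.re by linarith)
    refine this.congr fun m => ?_
    rw [Complex.cpow_neg, one_div]
  refine ⟨measurable_from_top, fun m => ?_, fun m => ⟨m + 1, rfl⟩, ?_, riemannZeta,
    fun _ => -1, fun w y => ∑ q ∈ Finset.Icc 1 ⌊y⌋₊, (q : ℂ) ^ (-w), fun w => ?_,
    fun w => MeromorphicAt.const _ _, fun n => ?_, fun n => analyticAt_const, fun y _ => ?_,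
    fun w => ?_, fun T => ?_, fun w hw y hy _ => ?_, fun n y hy _ => ?_⟩
  · exact_mod_cast m.succ_pos
  · rw [integrable_count_iff]
    have h : Summable fun m : ℕ => ((m : ℝ) ^ 2)⁻¹ := Real.summable_nat_pow_inv.2 (by norm_num)
    exact h.norm.comp_injective (add_left_injective 1)
  · rcases eq_or_ne w 1 with rfl | hw
    · have hev : ∀ᶠ z in 𝓝[≠] (1 : ℂ), DifferentiableAt ℂ riemannZeta z := by
        filter_upwards [self_mem_nhdsWithin] with z hz using differentiableAt_riemannZeta hz
      have hlim := riemannZeta_residue_one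
      -- The residue of `ζ` at `1` is `1`, so this value removes the singularity and leaves a simple
      -- pole.
      have hg : AnalyticAt ℂ (Function.update (fun s => (s - 1) * riemannZeta s) 1 1) 1 := by
        refine Complex.analyticAt_of_differentiable_on_punctured_nhds_of_continuousAt ?_
          (continuousAt_update_same.2 hlim)
        filter_upwards [self_mem_nhdsWithin] with z hz
        have : (fun s => (s - 1) * riemannZeta s) =ᶠ[𝓝 z]
            Function.update (fun s => (s - 1) * riemannZeta s) 1 1 := by
          filter_upwards [isOpen_ne.mem_nhds hz] with s hs
          rw [Function.update_of_ne hs]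
        refine DifferentiableAt.congr_of_eventuallyEq ?_ this.symm
        exact (by fun_prop : DifferentiableAt ℂ (fun s : ℂ => s - 1) z).mul
          (differentiableAt_riemannZeta hz)
      have hinv : MeromorphicAt (fun s : ℂ => (s - 1)⁻¹) 1 :=
        (show AnalyticAt ℂ (fun s : ℂ => s - 1) 1 by fun_prop).meromorphicAt.inv
      refine (hinv.mul hg.meromorphicAt).congr ?_
      filter_upwards [self_mem_nhdsWithin] with z hz
      have hz' : z - 1 ≠ 0 := sub_ne_zero.2 hz
      simp only [Pi.mul_apply, Function.update_of_ne (show z ≠ 1 from hz)]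
      field_simp
    · refine AnalyticAt.meromorphicAt (DifferentiableOn.analyticAt (s := {1}ᶜ)
        (fun z hz => (differentiableAt_riemannZeta hz).differentiableWithinAt)
        (isOpen_ne.mem_nhds hw))
  · refine DifferentiableOn.analyticAt (s := {1}ᶜ)
        (fun z hz => (differentiableAt_riemannZeta hz).differentiableWithinAt)
        (isOpen_ne.mem_nhds ?_)
    intro h
    have := congrArg Complex.re h
    simp only [Complex.neg_re, Complex.natCast_re, Complex.one_re] at this
    linarith [n.cast_nonneg (α := ℝ)]
  · refine Differentiable.fun_sum fun q hq => ?_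
    have hq0 : (q : ℂ) ≠ 0 := by
      have := (Finset.mem_Icc.1 hq).1
      exact_mod_cast (by omega : q ≠ 0)
    exact fun w => (differentiableAt_id.neg).const_cpow (Or.inl hq0)
  · exact (measurable_from_nat (f := fun N : ℕ => ∑ q ∈ Finset.Icc 1 N, (q : ℂ) ^ (-w))).comp
      Nat.measurable_floor
  · obtain ⟨B, hB⟩ := exists_nat_ge (-T)
    -- One power of `1 + y` more than each term needs, to count the at most `y` terms.
    refine ⟨1, B + 1, fun w hw y hy => ?_⟩
    have hterm : ∀ q ∈ Finset.Icc 1 ⌊y⌋₊, ‖(q : ℂ) ^ (-w)‖ ≤ (1 + y) ^ B := by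
      intro q hq
      rw [Finset.mem_Icc] at hq
      have hq1 : (1 : ℝ) ≤ q := by exact_mod_cast hq.1
      have hqy : (q : ℝ) ≤ y := (Nat.le_floor_iff hy).1 hq.2
      rw [Complex.norm_natCast_cpow_of_pos (by omega), Complex.neg_re]
      calc (q : ℝ) ^ (-w.re) ≤ (q : ℝ) ^ (B : ℝ) :=
            Real.rpow_le_rpow_of_exponent_le hq1 (by linarith)
        _ = (q : ℝ) ^ B := Real.rpow_natCast _ _
        _ ≤ (1 + y) ^ B := pow_le_pow_left₀ (by linarith) (by linarith) _
    calc ‖∑ q ∈ Finset.Icc 1 ⌊y⌋₊, (q : ℂ) ^ (-w)‖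
        ≤ ∑ q ∈ Finset.Icc 1 ⌊y⌋₊, (1 + y) ^ B := norm_sum_le_of_le _ hterm
      _ = ⌊y⌋₊ * (1 + y) ^ B := by simp
      _ ≤ (1 + y) * (1 + y) ^ B := by
          gcongr
          linarith [Nat.floor_le hy]
      _ = 1 * (1 + y) ^ (B + 1) := by ring
  · obtain ⟨p, rfl⟩ := hy
    simp only [Nat.coe_castAddMonoidHom, Nat.floor_natCast]
    have hs := hsum w hw
    have hs' : Summable fun m : ℕ => ((p + (m + 1) : ℕ) : ℂ) ^ (-w) :=
      hs.comp_injective fun a b h => by simpa using h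
    have h1 : ∫ x : ℕ, (((p : ℝ) + ((x + 1 : ℕ) : ℝ) : ℝ) : ℂ) ^ (-w) ∂Measure.count =
        ∑' x : ℕ, ((p + (x + 1) : ℕ) : ℂ) ^ (-w) := by
      rw [integral_countable]
      · refine tsum_congr fun x => ?_
        simp [Measure.real]
      · rw [integrable_count_iff]
        simpa using hs'.norm
    rw [h1, zeta_eq_tsum_one_div_nat_add_one_cpow (by linarith)]
    have h2 : Summable fun m : ℕ => ((m + 1 : ℕ) : ℂ) ^ (-w) :=
      (summable_nat_add_iff (f := fun m : ℕ => (m : ℂ) ^ (-w)) 1).2 hs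
    have h3 := h2.sum_add_tsum_nat_add p
    have h4 : ∑' n : ℕ, 1 / ((n : ℂ) + 1) ^ w = ∑' n : ℕ, ((n + 1 : ℕ) : ℂ) ^ (-w) :=
      tsum_congr fun n => by rw [Complex.cpow_neg, one_div]; push_cast; rfl
    have h5 : ∑ q ∈ Finset.Icc 1 p, (q : ℂ) ^ (-w) =
        ∑ i ∈ Finset.range p, ((i + 1 : ℕ) : ℂ) ^ (-w) := by
      rw [Finset.range_eq_Ico, Finset.sum_Ico_add' (fun i : ℕ => (i : ℂ) ^ (-w)) 0 p 1]
      rfl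
    rw [h4, h5, ← h3]
    have h6 : ∀ n : ℕ, p + (n + 1) = n + p + 1 := fun n => by omega
    simp only [h6]
    ring
  · obtain ⟨p, rfl⟩ := hy
    simp only [Nat.coe_castAddMonoidHom, Nat.floor_natCast, neg_neg, Complex.cpow_natCast]
    -- The Appell term `k = n + 1` is `ζ(-n)`; the others are minus Faulhaber's sum.
    rw [regularizedTail_X_pow, riemannZeta_neg_nat_eq_bernoulli', Polynomial.eval_smul,
      eval_appellPolynomial, Finset.sum_range_succ]
    have h := congrArg (fun x : ℚ => (x : ℂ)) (sum_Ico_pow p n)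
    push_cast at h
    have h' : Finset.Icc 1 p = Finset.Ico 1 (p + 1) := rfl
    rw [h', h]
    have hn : (n : ℂ) + 1 ≠ 0 := by exact_mod_cast n.succ_ne_zero
    simp only [Nat.choose_self, Nat.sub_self, pow_zero, Nat.cast_one, smul_eq_mul, mul_add,
      Finset.mul_sum]
    rw [add_comm]
    congr 1
    · refine Finset.sum_congr rfl fun k _ => ?_
      push_cast
      field_simp
    · field_simp

theorem integral_comp_add_right_Ioi {E : Type*} [NormedAddCommGroup E] [NormedSpace ℝ E]
    (f : ℝ → E) (b c : ℝ) : ∫ x in Ioi b, f (x + c) = ∫ x in Ioi (b + c), f x := by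
  have h := (measurePreserving_add_right volume c).setIntegral_preimage_emb
    (measurableEmbedding_addRight c) f (Ioi (b + c))
  rwa [preimage_add_const_Ioi, add_sub_cancel_right] at h

/-- The integral is `(y + 1 + a) ^ (1 - w) / (w - 1)`, and at `w = -n` the binomial theorem in `y`
and `1 + a` gives the Appell polynomial. The `max` makes the lower bound `1` hold at every real `x`
and changes nothing on the support of the measure. -/
theorem hasRegularizedTail_Ici {a : ℝ} (ha : 0 ≤ a) :
    HasRegularizedTail (volume.restrict (Ici (1 : ℝ))) ⊤ (fun x => max x 1 + a)
      (fun k => ((1 + a : ℝ) : ℂ) ^ k) := by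
  have hne : ∀ y : ℝ, 0 ≤ y → ((y + 1 + a : ℝ) : ℂ) ≠ 0 := fun y hy => by
    exact_mod_cast (by positivity : y + 1 + a ≠ 0)
  have hw1 : ∀ n : ℕ, (-n : ℂ) - 1 ≠ 0 := fun n h => by
    have := congrArg Complex.re h
    simp only [Complex.sub_re, Complex.neg_re, Complex.natCast_re, Complex.one_re,
      Complex.zero_re] at this
    linarith [n.cast_nonneg (α := ℝ)]
  refine ⟨by fun_prop, fun x => by linarith [le_max_right x 1], fun _ => trivial, ?_, fun _ => 0,
    fun w => (w - 1)⁻¹, fun w y => ((y + 1 + a : ℝ) : ℂ) ^ (1 - w),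
    fun w => MeromorphicAt.const _ _,
    fun w => (show AnalyticAt ℂ (fun w : ℂ => w - 1) w by fun_prop).meromorphicAt.inv,
    fun n => analyticAt_const,
    fun n => (show AnalyticAt ℂ (fun w : ℂ => w - 1) (-n) by fun_prop).inv (hw1 n),
    fun y hy w => ?_, fun w => by fun_prop, fun T => ?_, fun w hw y _ hy => ?_, fun n y _ hy => ?_⟩
  · have h1 : IntegrableOn (fun x : ℝ => x ^ (-2 : ℝ)) (Ici 1) :=
      (integrableOn_Ici_iff_integrableOn_Ioi).2
        (integrableOn_Ioi_rpow_of_lt (by norm_num) one_pos)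
    refine Integrable.mono' h1 (by fun_prop) ?_
    filter_upwards [ae_restrict_mem measurableSet_Ici] with x hx
    have hx1 : (1 : ℝ) ≤ x := hx
    rw [max_eq_left hx1, Real.norm_of_nonneg (by positivity), Real.rpow_neg (by linarith),
      show (2 : ℝ) = ((2 : ℕ) : ℝ) by norm_num, Real.rpow_natCast]
    gcongr
    linarith
  · exact ((differentiableAt_const _).sub differentiableAt_id).const_cpow (Or.inl (hne y hy))
  · obtain ⟨B, hB⟩ := exists_nat_ge (1 - T)
    -- From `y + 1 + a ≤ (1 + a) * (1 + y)`.
    refine ⟨(1 + a) ^ B, B, fun w hw y hy => ?_⟩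
    have h1 : 1 ≤ y + 1 + a := by linarith
    rw [Complex.norm_cpow_eq_rpow_re_of_pos (by linarith)]
    calc (y + 1 + a) ^ (1 - w).re ≤ (y + 1 + a) ^ (B : ℝ) :=
          Real.rpow_le_rpow_of_exponent_le h1 (by
            rw [Complex.sub_re, Complex.one_re]; linarith)
      _ = (y + 1 + a) ^ B := Real.rpow_natCast _ _
      _ ≤ ((1 + a) * (1 + y)) ^ B :=
          pow_le_pow_left₀ (by linarith) (by nlinarith [mul_nonneg ha hy]) _
      _ = (1 + a) ^ B * (1 + y) ^ B := mul_pow _ _ _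
  · have h1 : ∫ x in Ici (1 : ℝ), ((y + (max x 1 + a) : ℝ) : ℂ) ^ (-w) =
        ∫ x in Ioi (1 : ℝ), ((x + (y + a) : ℝ) : ℂ) ^ (-w) := by
      rw [integral_Ici_eq_integral_Ioi]
      refine setIntegral_congr_fun measurableSet_Ioi fun x hx => ?_
      have hx1 : (1 : ℝ) ≤ x := le_of_lt hx
      simp only [max_eq_left hx1]
      congr 2
      ring
    rw [h1, integral_comp_add_right_Ioi (fun t : ℝ => (t : ℂ) ^ (-w)) 1 (y + a),
      integral_Ioi_cpow_of_lt (by rw [Complex.neg_re]; linarith) (by linarith)]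
    have h2 : w - 1 ≠ 0 := fun h => by
      have := congrArg Complex.re h
      simp only [Complex.sub_re, Complex.one_re, Complex.zero_re] at this
      linarith
    have h3 : -w + 1 ≠ 0 := fun h => h2 (by linear_combination -h)
    beta_reduce
    rw [show 1 + (y + a) = y + 1 + a by ring, show 1 - w = -w + 1 by ring, zero_add,
      inv_mul_eq_div, div_eq_div_iff h3 h2]
    ring
  · rw [regularizedTail_X_pow, Polynomial.eval_smul, eval_appellPolynomial, zero_add]
    have hn : (n : ℂ) + 1 ≠ 0 := by exact_mod_cast n.succ_ne_zero
    have h2 : ((y + 1 + a : ℝ) : ℂ) ^ (1 - (-n : ℂ)) =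
        (((1 + a : ℝ) : ℂ) + (y : ℂ)) ^ (n + 1) := by
      rw [← Complex.cpow_natCast]
      push_cast
      congr 1 <;> ring
    simp only [h2, add_pow, smul_eq_mul]
    congr 1
    · rw [show (-n : ℂ) - 1 = -(n + 1) by ring, inv_neg, neg_div, one_div]
    · exact Finset.sum_congr rfl fun k _ => by ring

theorem hasIteratedContinuation_multipleZeta {r : ℕ} (n : Fin r → ℕ) :
    HasIteratedContinuation r multipleZeta (fun i => -(n i : ℂ))
      (nestedValue r n (fun _ k => ((bernoulli' k : ℚ) : ℂ)) 1) := by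
  have h := fun _ : Fin r => hasRegularizedTail_nat
  obtain ⟨A, hA⟩ := (eventually_integrable_nestedIntegral h 1).exists
  refine (hasIteratedContinuation_nestedIntegral h n 1).congr (A := A) fun s hs => ?_
  rw [nestedIntegral, integral_countable (hA s hs), multipleZeta,
    ← (Equiv.piCongrRight fun _ : Fin r => Equiv.pnatEquivNat).symm.tsum_eq]
  refine tsum_congr fun m => ?_
  simp only [Measure.real, Measure.pi_singleton, Measure.count_singleton, Finset.prod_const_one,
    ENNReal.toReal_one, one_smul, Polynomial.eval_one, mul_one, nestedKernel]
  refine Finset.prod_congr rfl fun j _ => ?_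
  simp

theorem multipleZetaIntegral_eq_nestedIntegral {r : ℕ} (a : Fin r → ℝ) (s : Fin r → ℂ) :
    nestedIntegral (volume.restrict (Ici (1 : ℝ))) (fun i x => max x 1 + a i) 1 s =
      multipleZetaIntegral a s := by
  have h1 : (Ici (1 : Fin r → ℝ)) = Set.pi univ fun _ => Ici (1 : ℝ) := by
    ext x
    simp [Pi.le_def]
  have hms : MeasurableSet (Ici (1 : Fin r → ℝ)) := measurableSet_Ici
  rw [nestedIntegral, multipleZetaIntegral, ← Measure.restrict_pi_pi, ← volume_pi, ← h1]
  refine setIntegral_congr_fun hms fun x hx => ?_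
  have hx' : ∀ i, max (x i) 1 = x i := fun i => max_eq_left (hx i)
  simp only [nestedKernel, hx', Polynomial.eval_one, mul_one]

theorem hasIteratedContinuation_multipleZetaIntegral {r : ℕ} (n : Fin r → ℕ) {a : Fin r → ℝ}
    (ha : ∀ i, 0 ≤ a i) :
    HasIteratedContinuation r (multipleZetaIntegral a) (fun i => -(n i : ℂ))
      (nestedValue r n (fun i k => ((1 + a i : ℝ) : ℂ) ^ k) 1) :=
  (hasIteratedContinuation_nestedIntegral (fun i => hasRegularizedTail_Ici (ha i)) n 1).congr
    (A := 0) fun s _ => multipleZetaIntegral_eq_nestedIntegral a s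

/-! ### Averages over the unit cube and Raabe's identity. -/

theorem setIntegral_unitCube_prod {r : ℕ} (f : Fin r → ℝ → ℂ) :
    ∫ t in Icc (0 : Fin r → ℝ) 1, ∏ i, f i (t i) = ∏ i, ∫ t in Icc (0 : ℝ) 1, f i t := by
  have h1 : (Icc (0 : Fin r → ℝ) 1) = Set.pi univ fun _ => Icc (0 : ℝ) 1 := by
    ext x
    simp [Pi.le_def]
  rw [h1, volume_pi, Measure.restrict_pi_pi, integral_fintype_prod_eq_prod]

theorem setIntegral_Icc_aeval (a : ℝ) (p : ℚ[X]) :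
    ∫ t in Icc (0 : ℝ) 1, Polynomial.aeval ((a + t : ℝ) : ℂ) (Polynomial.derivative p) =
      Polynomial.aeval ((a + 1 : ℝ) : ℂ) p - Polynomial.aeval (a : ℂ) p := by
  have hc : Continuous fun t : ℝ =>
      Polynomial.aeval ((a + t : ℝ) : ℂ) (Polynomial.derivative p) :=
    (Polynomial.continuous_aeval _).comp (by fun_prop)
  rw [integral_Icc_eq_integral_Ioc, ← intervalIntegral.integral_of_le zero_le_one,
    intervalIntegral.integral_eq_sub_of_hasDerivAt
      (f := fun t : ℝ => Polynomial.aeval ((a + t : ℝ) : ℂ) p) (fun t _ => ?_)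
      (hc.intervalIntegrable _ _)]
  · simp
  · have h1 : HasDerivAt (fun t : ℝ => ((a + t : ℝ) : ℂ)) 1 t :=
      ((hasDerivAt_id t).const_add a).ofReal_comp
    have h2 := (p.hasDerivAt_aeval ((a + t : ℝ) : ℂ)).comp t h1
    rw [mul_one] at h2
    exact h2

/-- `B_{k+1}` has derivative `(k+1) B_k` and unit difference `(k+1) x ^ k`. -/
theorem setIntegral_Icc_bernoulli (a : ℝ) (k : ℕ) :
    ∫ t in Icc (0 : ℝ) 1, Polynomial.aeval ((a + t : ℝ) : ℂ) (Polynomial.bernoulli k) =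
      (a : ℂ) ^ k := by
  have hk : (k : ℂ) + 1 ≠ 0 := by exact_mod_cast k.succ_ne_zero
  have h := setIntegral_Icc_aeval a (Polynomial.bernoulli (k + 1))
  have h2 := congrArg (Polynomial.aeval (a : ℂ)) (Polynomial.bernoulli_comp_one_add_X (k + 1))
  rw [Polynomial.aeval_comp] at h2
  simp only [map_add, map_one, Polynomial.aeval_X, add_tsub_cancel_right, nsmul_eq_mul, map_mul,
    map_natCast, map_pow] at h2
  rw [Polynomial.derivative_bernoulli_add_one] at h
  simp only [map_mul, map_add, map_natCast, map_one, integral_const_mul] at h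
  refine mul_left_cancel₀ hk ?_
  rw [h]
  push_cast at h2 ⊢
  rw [add_comm (a : ℂ) 1, h2]
  ring

theorem setIntegral_Icc_pow (a : ℝ) (m : ℕ) :
    ∫ t in Icc (0 : ℝ) 1, ((a + t : ℝ) : ℂ) ^ m =
      ∑ k ∈ Finset.range (m + 1), ((m + 1).choose k / (m + 1) : ℂ) * (a : ℂ) ^ k := by
  have hm : (m : ℂ) + 1 ≠ 0 := by exact_mod_cast m.succ_ne_zero
  have h := setIntegral_Icc_aeval a (Polynomial.X ^ (m + 1))
  simp only [Polynomial.derivative_X_pow, map_mul, map_pow, Polynomial.aeval_X,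
    Polynomial.aeval_C, integral_const_mul, add_tsub_cancel_right] at h
  refine mul_left_cancel₀ hm ?_
  simp only [Nat.cast_add, Nat.cast_one, map_add, map_natCast, map_one] at h
  rw [h, Complex.ofReal_add, Complex.ofReal_one, add_pow, Finset.sum_range_succ, Finset.mul_sum]
  simp only [one_pow, mul_one, Nat.choose_self, Nat.cast_one, add_sub_cancel_right]
  exact Finset.sum_congr rfl fun k _ => by field_simp

/-- The polynomial `a ↦ ∫_{[0,1]^r} P(a + t) dt`. -/
noncomputable def cubeAverage (r : ℕ) : MvPolynomial (Fin r) ℂ →ₗ[ℂ] MvPolynomial (Fin r) ℂ :=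
  (MvPolynomial.basisMonomials (Fin r) ℂ).constr ℂ fun m =>
    ∏ i, ∑ k ∈ Finset.range (m i + 1),
      MvPolynomial.C (((m i + 1).choose k / (m i + 1) : ℂ)) * MvPolynomial.X i ^ k

/-- The linear functional that sends `x ^ m` to the product of the Bernoulli numbers `B_{m_i}`. -/
noncomputable def bernoulliFunctional (r : ℕ) : MvPolynomial (Fin r) ℂ →ₗ[ℂ] ℂ :=
  (MvPolynomial.basisMonomials (Fin r) ℂ).constr ℂ fun m => ∏ i, ((bernoulli (m i) : ℚ) : ℂ)

theorem cubeAverage_monomial {r : ℕ} (m : Fin r →₀ ℕ) (c : ℂ) :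
    cubeAverage r (MvPolynomial.monomial m c) = c • ∏ i, ∑ k ∈ Finset.range (m i + 1),
      MvPolynomial.C (((m i + 1).choose k / (m i + 1) : ℂ)) * MvPolynomial.X i ^ k := by
  have h : MvPolynomial.monomial m c = c • MvPolynomial.basisMonomials (Fin r) ℂ m := by
    simp [MvPolynomial.smul_monomial]
  rw [h, map_smul, cubeAverage, Module.Basis.constr_basis]

theorem bernoulliFunctional_monomial {r : ℕ} (m : Fin r →₀ ℕ) (c : ℂ) :
    bernoulliFunctional r (MvPolynomial.monomial m c) =
      c * ∏ i, ((bernoulli (m i) : ℚ) : ℂ) := by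
  have h : MvPolynomial.monomial m c = c • MvPolynomial.basisMonomials (Fin r) ℂ m := by
    simp [MvPolynomial.smul_monomial]
  rw [h, map_smul, bernoulliFunctional, Module.Basis.constr_basis, smul_eq_mul]

theorem continuous_eval_shift {r : ℕ} (a : Fin r → ℝ) (P : MvPolynomial (Fin r) ℂ) :
    Continuous fun t : Fin r → ℝ => MvPolynomial.eval (fun i => ((a i + t i : ℝ) : ℂ)) P :=
  P.continuous_eval.comp (by fun_prop)

theorem eval_cubeAverage {r : ℕ} (a : Fin r → ℝ) (P : MvPolynomial (Fin r) ℂ) :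
    MvPolynomial.eval (fun i => (a i : ℂ)) (cubeAverage r P) =
      ∫ t in Icc (0 : Fin r → ℝ) 1, MvPolynomial.eval (fun i => ((a i + t i : ℝ) : ℂ)) P := by
  induction P using MvPolynomial.induction_on' with
  | monomial m c =>
    simp only [cubeAverage_monomial, MvPolynomial.smul_eval, MvPolynomial.eval_prod, map_sum,
      map_mul, map_pow, MvPolynomial.eval_C, MvPolynomial.eval_X, MvPolynomial.eval_monomial,
      integral_const_mul, Finsupp.prod_fintype _ _ fun _ => pow_zero _]
    rw [setIntegral_unitCube_prod fun i t => ((a i + t : ℝ) : ℂ) ^ m i]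
    simp only [setIntegral_Icc_pow]
  | add P Q hP hQ =>
    simp only [map_add, hP, hQ]
    exact (integral_add ((continuous_eval_shift a P).integrableOn_Icc)
      ((continuous_eval_shift a Q).integrableOn_Icc)).symm

/-- On monomials everything factors over the variables, and each factor is the Bernoulli recurrence
`∑_{k ≤ m} (m+1 choose k) B_k = 0` for `m > 0`. -/
theorem bernoulliFunctional_cubeAverage {r : ℕ} (P : MvPolynomial (Fin r) ℂ) :
    bernoulliFunctional r (cubeAverage r P) = MvPolynomial.eval 0 P := by
  induction P using MvPolynomial.induction_on' with
  | monomial m c =>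
    have hprod : ∀ p : Fin r → ℕ, (∏ i, (MvPolynomial.C (((m i + 1).choose (p i) / (m i + 1) : ℂ)) *
        MvPolynomial.X i ^ p i : MvPolynomial (Fin r) ℂ)) =
        MvPolynomial.monomial (Finsupp.equivFunOnFinite.symm p)
          (∏ i, ((m i + 1).choose (p i) / (m i + 1) : ℂ)) := by
      intro p
      rw [MvPolynomial.monomial_eq, Finset.prod_mul_distrib, map_prod,
        Finsupp.prod_fintype _ _ fun _ => pow_zero _]
      rfl
    have h1 : ∀ i, ∑ k ∈ Finset.range (m i + 1),
        ((m i + 1).choose k / (m i + 1) : ℂ) * ((bernoulli k : ℚ) : ℂ) =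
          if m i = 0 then 1 else 0 := by
      intro i
      have h := congrArg (fun x : ℚ => (x : ℂ)) (sum_bernoulli (m i + 1))
      push_cast at h
      have h' : ∑ k ∈ Finset.range (m i + 1),
        ((m i + 1).choose k / (m i + 1) : ℂ) * ((bernoulli k : ℚ) : ℂ) =
          (∑ k ∈ Finset.range (m i + 1), ((m i + 1).choose k : ℂ) * ((bernoulli k : ℚ) : ℂ)) /
            (m i + 1) := by
        rw [Finset.sum_div]
        exact Finset.sum_congr rfl fun k _ => by ring
      rw [h', h]
      by_cases hm : m i = 0 <;> simp [hm]
    rw [cubeAverage_monomial, map_smul, Finset.prod_univ_sum, map_sum]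
    simp only [hprod, bernoulliFunctional_monomial, Finsupp.equivFunOnFinite_symm_apply_apply,
      ← Finset.prod_mul_distrib]
    rw [← Finset.prod_univ_sum (fun i => Finset.range (m i + 1)) fun i k =>
      ((m i + 1).choose k / (m i + 1) : ℂ) * ((bernoulli k : ℚ) : ℂ)]
    rw [MvPolynomial.eval_monomial, Finsupp.prod_fintype _ _ fun _ => pow_zero _]
    simp only [h1, smul_eq_mul, Pi.zero_apply, zero_pow_eq]
  | add P Q hP hQ => simp only [map_add, hP, hQ]

theorem eval_zero_eq_of_cubeIntegral_eq {r : ℕ} {P Q : MvPolynomial (Fin r) ℂ}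
    (h : ∀ a : Fin r → ℝ, (∀ i, 0 ≤ a i) →
      ∫ t in Icc (0 : Fin r → ℝ) 1, MvPolynomial.eval (fun i => ((a i + t i : ℝ) : ℂ)) P =
      ∫ t in Icc (0 : Fin r → ℝ) 1, MvPolynomial.eval (fun i => ((a i + t i : ℝ) : ℂ)) Q) :
    MvPolynomial.eval 0 P = MvPolynomial.eval 0 Q := by
  have hPQ : cubeAverage r P = cubeAverage r Q := by
    -- The averages agree only at non-negative real shifts, a product of infinite sets, which
    -- already determines a polynomial.
    refine MvPolynomial.funext_set (fun _ => (fun x : ℝ => (x : ℂ)) '' Ici 0)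
      (fun _ => (Set.Ici_infinite 0).image Complex.ofReal_injective.injOn) fun x hx => ?_
    choose a ha hax using fun i => hx i (mem_univ i)
    obtain rfl : (fun i => (a i : ℂ)) = x := funext hax
    rw [eval_cubeAverage, eval_cubeAverage, h a ha]
  rw [← bernoulliFunctional_cubeAverage, hPQ, bernoulliFunctional_cubeAverage]

/-- The polynomial in the shift `a` that is the regularized value of the shifted multiple zeta
function at `(-n_1, …, -n_r)`. -/
noncomputable def raabePolynomial {r : ℕ} (n : Fin r → ℕ) : MvPolynomial (Fin r) ℂ :=
  ∑ k ∈ constantTuples n,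
    MvPolynomial.C (∏ j, (-(((Ring.choose (faulhaberUpper n k j) (k j) : ℤ) : ℂ) /
        ((faulhaberUpper n k j : ℤ) : ℂ)))) *
      ∏ j, Polynomial.aeval (1 + MvPolynomial.X j : MvPolynomial (Fin r) ℂ)
        (Polynomial.bernoulli (k j))

theorem eval_raabePolynomial {r : ℕ} (n : Fin r → ℕ) (x : Fin r → ℂ) :
    MvPolynomial.eval x (raabePolynomial n) = nestedValue r n
      (fun i k => Polynomial.aeval (1 + x i) (Polynomial.bernoulli k)) 1 := by
  have h : ∀ (j : Fin r) (p : ℚ[X]), MvPolynomial.eval x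
      (Polynomial.aeval (1 + MvPolynomial.X j : MvPolynomial (Fin r) ℂ) p) =
        Polynomial.aeval (1 + x j) p := by
    intro j p
    have := Polynomial.aeval_algHom_apply ((MvPolynomial.aeval x).restrictScalars ℚ :
      MvPolynomial (Fin r) ℂ →ₐ[ℚ] ℂ) (1 + MvPolynomial.X j : MvPolynomial (Fin r) ℂ) p
    simpa [MvPolynomial.aeval_eq_eval] using this.symm
  rw [nestedValue_one, raabePolynomial]
  simp only [map_sum, map_mul, MvPolynomial.eval_C, map_prod, h]

/-- In `nestedValue_one` each term carries exactly one factor `β_j (k_j)` per variable, so the cube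
average factors and turns every `B_k(1 + a_i + t_i)` into `(1 + a_i) ^ k`. -/
theorem cubeIntegral_raabePolynomial {r : ℕ} (n : Fin r → ℕ) (a : Fin r → ℝ) :
    ∫ t in Icc (0 : Fin r → ℝ) 1,
      MvPolynomial.eval (fun i => ((a i + t i : ℝ) : ℂ)) (raabePolynomial n) =
        nestedValue r n (fun i k => ((1 + a i : ℝ) : ℂ) ^ k) 1 := by
  simp only [eval_raabePolynomial, nestedValue_one]
  have hcast : ∀ x t : ℝ, (1 : ℂ) + ((x + t : ℝ) : ℂ) = ((1 + x + t : ℝ) : ℂ) := fun x t => by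
    push_cast; ring
  simp only [hcast]
  rw [integral_finsetSum]
  · refine Finset.sum_congr rfl fun k _ => ?_
    rw [integral_const_mul, setIntegral_unitCube_prod fun i t =>
      Polynomial.aeval ((1 + a i + t : ℝ) : ℂ) (Polynomial.bernoulli (k i))]
    simp only [setIntegral_Icc_bernoulli]
  · intro k _
    exact Continuous.integrableOn_Icc (continuous_const.mul (continuous_finsetProd _ fun i _ =>
      (Polynomial.continuous_aeval _).comp (by fun_prop)))

theorem eval_zero_raabePolynomial {r : ℕ} (n : Fin r → ℕ) :
    MvPolynomial.eval 0 (raabePolynomial n) =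
      nestedValue r n (fun _ k => ((bernoulli' k : ℚ) : ℂ)) 1 := by
  rw [eval_raabePolynomial]
  congr 1
  ext i k
  rw [Pi.zero_apply, add_zero, ← map_one (algebraMap ℚ ℂ), Polynomial.aeval_algebraMap_apply,
    Polynomial.coe_aeval_eq_eval, Polynomial.bernoulli_eval_one]
  rfl

/-! ### Comparison of the values. -/

theorem isRaabeValue_iff {r : ℕ} (n : Fin r → ℕ) (z : ℂ) :
    IsRaabeValue n z ↔ z = nestedValue r n (fun _ k => ((bernoulli' k : ℚ) : ℂ)) 1 := by
  rw [← eval_zero_raabePolynomial]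
  constructor
  · rintro ⟨P, hP, rfl⟩
    refine eval_zero_eq_of_cubeIntegral_eq fun a ha => ?_
    rw [cubeIntegral_raabePolynomial]
    exact (hP a ha).unique (hasIteratedContinuation_multipleZetaIntegral n ha)
  · rintro rfl
    refine ⟨raabePolynomial n, fun a ha => ?_, rfl⟩
    rw [cubeIntegral_raabePolynomial]
    exact hasIteratedContinuation_multipleZetaIntegral n ha

theorem mainTheorem3 (r : ℕ) (hr : 1 ≤ r) (n : Fin r → ℕ) :
    (∀ z : ℂ, IsRaabeValue n z ↔
      (-1) ^ (∑ i, n i) * z = (formalConstantTerm n : ℂ)) ∧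
    (∀ z : ℂ, HasIteratedContinuation r multipleZeta (fun i => -(n i : ℂ)) z ↔
      (-1) ^ (∑ i, n i) * z = (formalConstantTerm n : ℂ)) := by
  have hne : ((-1 : ℂ)) ^ (∑ i, n i) ≠ 0 := pow_ne_zero _ (by norm_num)
  have hz : ∀ z : ℂ, (-1) ^ (∑ i, n i) * z = (formalConstantTerm n : ℂ) ↔
      z = nestedValue r n (fun _ k => ((bernoulli' k : ℚ) : ℂ)) 1 := fun z => by
    rw [← nestedValue_bernoulli', mul_right_inj' hne]
  refine ⟨fun z => by rw [hz, isRaabeValue_iff], fun z => ?_⟩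
  rw [hz]
  constructor
  · exact fun h => h.unique (hasIteratedContinuation_multipleZeta n)
  · rintro rfl
    exact hasIteratedContinuation_multipleZeta n
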